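/- Let $G$ be a group with a Garside structure $(G,P,\Delta)$ of finite type. That is: $P\subseteq G$ is a submonoid with $P\cap P^{-1}=\{1\}$ and $\Delta\in P$; the order $a\preccurlyeq b\Leftrightarrow a^{-1}b\in P$ is a lattice order on $G$, with greatest common divisor $\wedge$; the set $[1,\Delta]=\{a\in G : 1\preccurlyeq a\preccurlyeq\Delta\}$ of simple elements is finite and generates $G$; $\Delta^{-1}P\Delta=P$; and for every $x\in P\setminus\{1\}$ the number $$\|x\|=\sup\{k : x=a_1\cdots a_k \text{ for some } a_1,\dots,a_k\in P\setminus\{1\}\}$$ is finite (put $\|1\|=0$). Every $x\in G$ has a left normal form $x=\Delta^p x_1\cdots x_r$ with $p\in\mathbb Z$, $r\ge 0$, $x_i\in[1,\Delta]\setminus\{1,\Delta\}$ and $(x_i^{-1}\Delta)\wedge x_{i+1}=1$ for $1\le i<r$; it is unique if $\Delta\ne 1$, and if $\Delta=1$ (so that $G$ is trivial) one value of $p$ is fixed arbitrarily. Write $\inf(x)=p$, $\ell(x)=r$, $\sup(x)=p+r$. The super summit set ${\rm SSS}(x)$ is the set of conjugates of $x$ whose infimum is maximal and whose supremum is minimal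 in the conjugacy class of $x$. Let $\iota(x)=x\Delta^{-\inf(x)}\wedge\Delta$ and $\mathfrak p(x)=\iota(x)\wedge\iota(x^{-1})$. The cyclic sliding of $x$ is $\mathfrak s(x)=\mathfrak p(x)^{-1}\,x\,\mathfrak p(x)$. **Corollary.** Let $x\in G$ with $\ell(x)=r$. There exists an integer $M\le (r-1)(\|\Delta\|-1)$ such that $\mathfrak s^m(x)\in{\rm SSS}(x)$ for all integers $m\ge 0$ with $m\ge M$. (The integer $M$ may be negative, which matters only when $r=0$.) -/

import Mathlib

/-- A Garside structure `(G, P, Δ)` on a group `G`.  The prefix order `a ≼ b` is `a⁻¹ * b ∈ P`. -/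
structure GarsideStructure (G : Type*) [Group G] where
  /-- The monoid `P` of positive elements. -/
  P : Submonoid G
  /-- The Garside element. -/
  Δ : G
  Δ_mem : Δ ∈ P
  /-- `P ∩ P⁻¹ = {1}`. -/
  eq_one_of_mem_of_inv_mem : ∀ a : G, a ∈ P → a⁻¹ ∈ P → a = 1
  /-- Any two elements have a least common multiple with respect to `≼`. -/
  exists_join : ∀ a b : G, ∃ c : G, a⁻¹ * c ∈ P ∧ b⁻¹ * c ∈ P ∧
    ∀ d : G, a⁻¹ * d ∈ P → b⁻¹ * d ∈ P → c⁻¹ * d ∈ P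
  /-- Any two elements have a greatest common divisor with respect to `≼`. -/
  exists_meet : ∀ a b : G, ∃ c : G, c⁻¹ * a ∈ P ∧ c⁻¹ * b ∈ P ∧
    ∀ d : G, d⁻¹ * a ∈ P → d⁻¹ * b ∈ P → d⁻¹ * c ∈ P
  /-- The simple elements, that is, the `a` with `1 ≼ a ≼ Δ`, generate `G`. -/
  closure_simple : Subgroup.closure {a : G | a ∈ P ∧ a⁻¹ * Δ ∈ P} = ⊤
  /-- `Δ⁻¹ P Δ = P`. -/
  conj_mem_iff : ∀ a : G, Δ⁻¹ * a * Δ ∈ P ↔ a ∈ P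
  /-- The lengths of the factorisations of a nontrivial positive element into nontrivial positive
  elements are bounded. -/
  bddAbove_length : ∀ x : G, x ∈ P → x ≠ 1 →
    BddAbove {k : ℕ | ∃ l : List G, l.length = k ∧ (∀ a ∈ l, a ∈ P ∧ a ≠ 1) ∧ l.prod = x}

namespace GarsideStructure

variable {G : Type*} [Group G] (S : GarsideStructure G)

/-- The prefix order `a ≼ b`. -/
def PrefixLE (a b : G) : Prop := a⁻¹ * b ∈ S.P

/-- The set `[1, Δ]` of simple elements. -/
def simples : Set G := {a : G | S.PrefixLE 1 a ∧ S.PrefixLE a S.Δ}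

/-- The structure is of finite type if there are finitely many simple elements. -/
def IsFiniteType : Prop := S.simples.Finite

/-- `‖x‖`, the maximal number of factors in a factorisation of the positive element `x` into
nontrivial positive elements; it is `0` for `x = 1`. -/
noncomputable def posNorm (x : G) : ℕ :=
  sSup {k : ℕ | ∃ l : List G, l.length = k ∧ (∀ a ∈ l, a ∈ S.P ∧ a ≠ 1) ∧ l.prod = x}

/-- The greatest common divisor `a ∧ b` with respect to `≼`. -/
noncomputable def meet (a b : G) : G := Classical.choose (S.exists_meet a b)

/-- The right complement `∂(a) = a⁻¹ Δ`. -/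
def rightCompl (a : G) : G := a⁻¹ * S.Δ

/-- The decomposition `a · b` is left weighted: `∂(a) ∧ b = 1`. -/
def IsLeftWeighted (a b : G) : Prop := S.meet (S.rightCompl a) b = 1

/-- `x = Δ ^ p * x₁ * ⋯ * x_r`, with `l = [x₁, …, x_r]`, is the left normal form of `x`. -/
def IsLeftNormalForm (x : G) (p : ℤ) (l : List G) : Prop :=
  x = S.Δ ^ p * l.prod ∧
  (∀ a ∈ l, a ∈ S.simples ∧ a ≠ 1 ∧ a ≠ S.Δ) ∧
  l.IsChain S.IsLeftWeighted

/-- The left normal form of `x`, as the pair of `p` and `[x₁, …, x_r]`. -/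
noncomputable def leftNormalForm (x : G) : ℤ × List G :=
  Classical.epsilon fun f : ℤ × List G => S.IsLeftNormalForm x f.1 f.2

/-- The infimum `inf(x) = p`. -/
noncomputable def infimum (x : G) : ℤ := (S.leftNormalForm x).1

/-- The canonical length `ℓ(x) = r`. -/
noncomputable def canonicalLength (x : G) : ℕ := (S.leftNormalForm x).2.length

/-- The supremum `sup(x) = p + r`. -/
noncomputable def supremum (x : G) : ℤ := S.infimum x + S.canonicalLength x

/-- The initial factor `ι(x) = x Δ^{-inf(x)} ∧ Δ`. -/
noncomputable def initialFactor (x : G) : G := S.meet (x * S.Δ ^ (-S.infimum x)) S.Δ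

/-- The preferred prefix `𝔭(x) = ι(x) ∧ ι(x⁻¹)`. -/
noncomputable def preferredPrefix (x : G) : G := S.meet (S.initialFactor x) (S.initialFactor x⁻¹)

/-- The cyclic sliding `𝔰(x) = 𝔭(x)⁻¹ x 𝔭(x)`. -/
noncomputable def cyclicSliding (x : G) : G :=
  (S.preferredPrefix x)⁻¹ * x * S.preferredPrefix x

/-- The super summit set of `x`: the conjugates of `x` whose infimum is maximal and whose supremum
is minimal in the conjugacy class of `x`. -/
def superSummitSet (x : G) : Set G :=
  {y : G | IsConj x y ∧
    (∀ z : G, IsConj x z → S.infimum z ≤ S.infimum y) ∧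
    (∀ z : G, IsConj x z → S.supremum y ≤ S.supremum z)}

end GarsideStructure

/-!
Fix `x` with infimum `p` and supremum `s`. Left multiplication by `x` and right multiplication by
powers of `Δ` are automorphisms of the prefix order, hence so are `h(a) = x a Δ^{-(p+1)}` and
`h'(a) = x⁻¹ a Δ^{s-1}`. A conjugate `a⁻¹ x a` has infimum greater than `p` exactly when `a ≼ h(a)`,
and supremum less than `s` exactly when `a ≼ h'(a)`. So raising the infimum means finding a point
`a` with `a ≼ h(a)`.

Suppose that some conjugate of `x` has a larger infimum. Then there is `b₀ ≼ 1` with `b₀ ≼ h(b₀)`,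
and the sequence `c₀ = 1`, `c_{j+1} = c_j ∧ h(c_j)`, which is bounded below by `b₀`, decreases to
the greatest such point `b`. It arrives there within `‖Δ‖ - 1` steps (`eq_of_norm_le`): the truncations
`c_j ∧ bΔ` lie between `b` and `bΔ`, start strictly below `bΔ`, and decrease strictly until they
equal `b`, and an element above `b` whose meet with `bΔ` is `b` equals `b`.

If `ℓ(x) ≥ 2` and the first sliding steps do not shorten `x`, then, with `u_j` the product of the
first `j` preferred prefixes, `a_j = u_j Δ^{-j}` satisfies `a_{j+1} = a_j ∧ h(a_j) ∧ h'(a_j)`.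
As `h` and `h'` commute and `h h'` is right multiplication by `Δ^{ℓ(x)-2}`, we have `a ≼ h(h'(a))`;
this gives `a_j ∧ c_{j+1} ≼ h(a_j)` (`inf_succ_le_map`), so `a_j ≼ h(a_j)` as soon as `c_j` is
stable, and the infimum has increased after all. Hence `‖Δ‖ - 1` slidings shorten `x`
(`canonicalLength_iterate_lt_of_infimum_lt`). The case of the supremum follows by passing to `x⁻¹`,
because sliding commutes with inversion.

If `ℓ(x) ≤ 1`, then `h(1) ≼ 1`, and the decreasing sequence `h^j(1)` can only be bounded below by
some `b₀` if `1 ≼ h(1)`, which contradicts `inf(x) = p`; so `x` is in its super summit set. An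
element of length `r ≥ 1` therefore gets there after at most `r - 1` rounds of `‖Δ‖ - 1` slidings,
and stays.
-/

namespace GarsideStructure

/-! ### Iteration of an endomorphism of a semilattice -/

section SemilatticeInf

variable {L : Type*} [SemilatticeInf L] {h : L → L} {c : ℕ → L}

theorem le_of_le_map_of_le (hh : ∀ a b, h (a ⊓ b) = h a ⊓ h b)
    (hc : ∀ j, c (j + 1) = c j ⊓ h (c j)) {y : L} (hy : y ≤ h y) (hy0 : y ≤ c 0) (j : ℕ) :
    y ≤ c j := by
  have hm : Monotone h := .of_map_inf hh
  induction j with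
  | zero => exact hy0
  | succ j ih => rw [hc]; exact le_inf ih (hy.trans (hm ih))

/-- A decreasing sequence bounded below by `b` stabilises, because the norm `ν` counts down along
it. -/
theorem exists_le_map (hc : ∀ j, c (j + 1) = c j ⊓ h (c j)) {b : L} (hb : ∀ j, b ≤ c j)
    {ν : L → ℕ} (hν : ∀ y z, b ≤ y → y < z → ν y < ν z) : ∃ j, c j ≤ h (c j) := by
  by_contra! hcon
  have hlt : ∀ j, c (j + 1) < c j := fun j => by
    rw [hc]
    exact lt_of_le_of_ne inf_le_left fun he => hcon j (inf_eq_left.1 he)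
  have : ∀ j, ν (c j) + j ≤ ν (c 0) := fun j => by
    induction j with
    | zero => simp
    | succ j ih => have := hν _ _ (hb _) (hlt j); omega
  have := this (ν (c 0) + 1)
  omega

/-- If the lower bound `b` of the sequence `c` lies above every `y ≤ c 0` with `y ≤ h y`, then `c`
reaches `b` within `ν d - ν b - 1` steps. The truncations `c j ⊓ d` obey the same recursion as `c`,
since `d ≤ h d`, and they decrease strictly until they reach `b`, which by `htriv` only
happens when `c j = b`. -/
theorem eq_of_norm_le (hh : ∀ a b, h (a ⊓ b) = h a ⊓ h b)
    (hc : ∀ j, c (j + 1) = c j ⊓ h (c j)) {b d : L} (hb : ∀ j, b ≤ c j)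
    (hmax : ∀ y, y ≤ h y → y ≤ c 0 → y ≤ b) (hbd : b < d) (hd : d ≤ h d)
    (htriv : ∀ y, b ≤ y → y ⊓ d = b → y = b)
    {ν : L → ℕ} (hν : ∀ y z, b ≤ y → y < z → ν y < ν z)
    {k : ℕ} (hk : ν d ≤ ν b + k + 1) : c k = b := by
  have hanti : ∀ j, c j ≤ c 0 := fun j => by
    induction j with
    | zero => exact le_rfl
    | succ j ih => rw [hc]; exact inf_le_left.trans ih
  have hstep : ∀ j, c (j + 1) ⊓ d = (c j ⊓ d) ⊓ h (c j ⊓ d) := fun j => by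
    rw [hh, hc]
    apply le_antisymm
    · refine le_inf (le_inf ?_ ?_) (le_inf ?_ ?_)
      · exact inf_le_left.trans inf_le_left
      · exact inf_le_right
      · exact inf_le_left.trans inf_le_right
      · exact inf_le_right.trans hd
    · refine le_inf (le_inf ?_ ?_) ?_
      · exact inf_le_left.trans inf_le_left
      · exact inf_le_right.trans inf_le_left
      · exact inf_le_left.trans inf_le_right
  have hbe : ∀ j, b ≤ c j ⊓ d := fun j => le_inf (hb j) hbd.le
  have hlt : c 0 ⊓ d < d :=
    lt_of_le_of_ne inf_le_right fun he => (hmax d hd (inf_eq_right.1 he)).not_gt hbd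
  have key : ∀ j, c j ⊓ d = b ∨ ν (c j ⊓ d) + j + 1 ≤ ν d := fun j => by
    induction j with
    | zero => exact Or.inr (hν _ _ (hbe 0) hlt)
    | succ j ih =>
      rcases eq_or_ne (c (j + 1) ⊓ d) (c j ⊓ d) with he | he
      -- A stationary truncation is a point below its image, hence is at most `b`.
      · refine Or.inl (le_antisymm ?_ (hbe _))
        rw [he]
        refine hmax _ ?_ (inf_le_left.trans (hanti j))
        rw [hstep] at he
        exact inf_eq_left.1 he
      · have hlt' : c (j + 1) ⊓ d < c j ⊓ d :=
          lt_of_le_of_ne (by rw [hstep]; exact inf_le_left) he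
        rcases ih with ih | ih
        · exact absurd (hlt'.trans_eq ih) (hbe _).not_gt
        · have := hν _ _ (hbe _) hlt'
          exact Or.inr (by omega)
  refine htriv _ (hb k) ?_
  rcases key k with hk' | hk'
  · exact hk'
  · by_contra hne
    have := hν _ _ le_rfl (lt_of_le_of_ne (hbe k) (Ne.symm hne))
    omega

/-- The sequence `a`, which descends faster than `c` because of the additional map `h'`, is still
controlled by `c`: the two maps almost cancel, by `a ≤ h (h' a)`. -/
theorem inf_succ_le_map (hh : ∀ a b, h (a ⊓ b) = h a ⊓ h b)
    (hc : ∀ j, c (j + 1) = c j ⊓ h (c j)) {h' : L → L} (hhh' : ∀ a, a ≤ h (h' a))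
    {a : ℕ → L} {k : ℕ} (ha0 : a 0 = c 0)
    (ha : ∀ j < k, a (j + 1) = a j ⊓ h (a j) ⊓ h' (a j)) {j : ℕ} (hj : j ≤ k) :
    a j ⊓ c (j + 1) ≤ h (a j) := by
  have hm : Monotone h := .of_map_inf hh
  induction j with
  | zero => rw [ha0, hc]; exact inf_le_right.trans inf_le_right
  | succ j ih =>
    have h1 : a (j + 1) ≤ h (a j) := by
      rw [ha j hj]; exact inf_le_left.trans inf_le_right
    have h2 : a (j + 1) ≤ a j := by
      rw [ha j hj]; exact inf_le_left.trans inf_le_left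
    have h3 : c (j + 1 + 1) ≤ h (c (j + 1)) := by rw [hc (j + 1)]; exact inf_le_right
    conv_rhs => rw [ha j hj, hh, hh]
    refine le_inf (le_inf (inf_le_left.trans h1) ?_) ((inf_le_left.trans h2).trans (hhh' _))
    refine (inf_le_inf h1 h3).trans ?_
    rw [← hh]
    exact hm (ih (by omega))

/-- Once `c` is stable at `k`, so that `c k ≤ h (c k)`, the same holds for `a`. -/
theorem le_map_of_stable (hh : ∀ a b, h (a ⊓ b) = h a ⊓ h b)
    (hc : ∀ j, c (j + 1) = c j ⊓ h (c j)) {h' : L → L} (hhh' : ∀ a, a ≤ h (h' a))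
    {a : ℕ → L} {k : ℕ} (ha0 : a 0 = c 0)
    (ha : ∀ j < k, a (j + 1) = a j ⊓ h (a j) ⊓ h' (a j)) (hck : c k ≤ h (c k)) :
    a k ≤ h (a k) := by
  have hm : Monotone h := .of_map_inf hh
  have hac : ∀ j ≤ k, a j ≤ c j := fun j hj => by
    induction j with
    | zero => exact ha0.le
    | succ j ih =>
      rw [ha j hj, hc]
      exact inf_le_left.trans (inf_le_inf (ih (by omega)) (hm (ih (by omega))))
  refine le_trans (le_inf le_rfl ?_) (inf_succ_le_map hh hc hhh' ha0 ha le_rfl)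
  rw [hc]
  exact le_inf (hac k le_rfl) ((hac k le_rfl).trans hck)

end SemilatticeInf

/-! ### The prefix order and its translations -/

variable {G : Type*} [Group G] (S : GarsideStructure G)

theorem prefixLE_refl (a : G) : S.PrefixLE a a := by
  simp [PrefixLE, S.P.one_mem]

variable {S} in
theorem PrefixLE.trans {a b c : G} (hab : S.PrefixLE a b) (hbc : S.PrefixLE b c) :
    S.PrefixLE a c := by
  have := S.P.mul_mem hab hbc
  simpa [PrefixLE, mul_assoc] using this

variable {S} in
theorem PrefixLE.antisymm {a b : G} (hab : S.PrefixLE a b) (hba : S.PrefixLE b a) : a = b := by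
  have := S.eq_one_of_mem_of_inv_mem (a⁻¹ * b) hab (by simpa [PrefixLE] using hba)
  exact inv_mul_eq_one.1 this

theorem meet_prefixLE_left (a b : G) : S.PrefixLE (S.meet a b) a :=
  (Classical.choose_spec (S.exists_meet a b)).1

theorem meet_prefixLE_right (a b : G) : S.PrefixLE (S.meet a b) b :=
  (Classical.choose_spec (S.exists_meet a b)).2.1

variable {S} in
theorem PrefixLE.meet {a b d : G} (ha : S.PrefixLE d a) (hb : S.PrefixLE d b) :
    S.PrefixLE d (S.meet a b) :=
  (Classical.choose_spec (S.exists_meet a b)).2.2 d ha hb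

/-- The prefix order as a meet-semilattice. It is not a global instance because `G` does not
determine the Garside structure. -/
@[reducible]
noncomputable def semilatticeInf : SemilatticeInf G where
  le := S.PrefixLE
  le_refl := S.prefixLE_refl
  le_trans _ _ _ := PrefixLE.trans
  le_antisymm _ _ := PrefixLE.antisymm
  inf := S.meet
  inf_le_left := S.meet_prefixLE_left
  inf_le_right := S.meet_prefixLE_right
  le_inf _ _ _ := PrefixLE.meet

theorem meet_comm (a b : G) : S.meet a b = S.meet b a :=
  (PrefixLE.meet (S.meet_prefixLE_right a b) (S.meet_prefixLE_left a b)).antisymm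
    (PrefixLE.meet (S.meet_prefixLE_right b a) (S.meet_prefixLE_left b a))

variable {S} in
theorem PrefixLE.meet_eq_left {a b : G} (hab : S.PrefixLE a b) : S.meet a b = a :=
  (S.meet_prefixLE_left a b).antisymm ((S.prefixLE_refl a).meet hab)

@[simp]
theorem one_prefixLE {a : G} : S.PrefixLE 1 a ↔ a ∈ S.P := by simp [PrefixLE]

@[simp]
theorem mul_prefixLE_mul_left {c a b : G} : S.PrefixLE (c * a) (c * b) ↔ S.PrefixLE a b := by
  simp [PrefixLE, mul_assoc]

theorem conj_zpow_mem_iff (n : ℤ) (a : G) : S.Δ ^ (-n) * a * S.Δ ^ n ∈ S.P ↔ a ∈ S.P := by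
  induction n using Int.induction_on generalizing a with
  | zero => simp
  | succ n ih =>
    rw [← ih a, ← S.conj_mem_iff (S.Δ ^ (-(n : ℤ)) * a * S.Δ ^ (n : ℤ)), zpow_add_one, neg_add_rev,
      zpow_add, zpow_neg_one]
    simp only [mul_assoc]
  | pred n ih =>
    rw [← ih a, ← S.conj_mem_iff]
    simp [zpow_add, zpow_sub, zpow_neg, mul_assoc]

@[simp]
theorem mul_prefixLE_mul_zpow {a b : G} (n : ℤ) :
    S.PrefixLE (a * S.Δ ^ n) (b * S.Δ ^ n) ↔ S.PrefixLE a b := by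
  rw [PrefixLE, PrefixLE, ← S.conj_zpow_mem_iff n (a⁻¹ * b)]
  simp [mul_assoc]

/-- The translations `a ↦ x a Δ^n`, which are automorphisms of the prefix order. -/
def translate (x : G) (n : ℤ) (a : G) : G := x * a * S.Δ ^ n

@[simp]
theorem translate_prefixLE_translate {x a b : G} {n : ℤ} :
    S.PrefixLE (S.translate x n a) (S.translate x n b) ↔ S.PrefixLE a b := by
  simp [translate]

theorem translate_translate (x y a : G) (m n : ℤ) :
    S.translate x m (S.translate y n a) = S.translate (x * y) (n + m) a := by
  simp [translate, mul_assoc, zpow_add]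

theorem translate_one_zero (a : G) : S.translate 1 0 a = a := by simp [translate]

theorem translate_meet (x : G) (n : ℤ) (a b : G) :
    S.translate x n (S.meet a b) = S.meet (S.translate x n a) (S.translate x n b) := by
  refine PrefixLE.antisymm (PrefixLE.meet (by simp [meet_prefixLE_left])
    (by simp [meet_prefixLE_right])) ?_
  have key : ∀ d, S.translate x n (S.translate x⁻¹ (-n) d) = d := fun d => by
    simp [translate_translate, translate_one_zero]
  rw [← key (S.meet (S.translate x n a) (S.translate x n b)), translate_prefixLE_translate]
  refine PrefixLE.meet ?_ ?_ <;> rw [← S.translate_prefixLE_translate (x := x) (n := n), key]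
  · exact S.meet_prefixLE_left _ _
  · exact S.meet_prefixLE_right _ _

theorem mul_meet (x a b : G) : x * S.meet a b = S.meet (x * a) (x * b) := by
  simpa [translate] using S.translate_meet x 0 a b

theorem meet_mul_zpow (a b : G) (n : ℤ) :
    S.meet a b * S.Δ ^ n = S.meet (a * S.Δ ^ n) (b * S.Δ ^ n) := by
  simpa [translate] using S.translate_meet 1 n a b

/-! ### Powers of the Garside element -/

theorem zpow_prefixLE_zpow {m n : ℤ} (hmn : m ≤ n) : S.PrefixLE (S.Δ ^ m) (S.Δ ^ n) := by
  obtain ⟨k, rfl⟩ := Int.le.dest hmn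
  simpa [PrefixLE, zpow_add] using S.P.pow_mem S.Δ_mem k

theorem mul_zpow_prefixLE_mul_zpow (a : G) {m n : ℤ} (hmn : m ≤ n) :
    S.PrefixLE (a * S.Δ ^ m) (a * S.Δ ^ n) := by
  simpa using S.zpow_prefixLE_zpow hmn

variable {S} in
theorem le_of_zpow_prefixLE_zpow (hΔ : S.Δ ≠ 1) {m n : ℤ}
    (h : S.PrefixLE (S.Δ ^ m) (S.Δ ^ n)) : m ≤ n := by
  by_contra! hlt
  have h1 : S.PrefixLE (S.Δ ^ (n + 1)) (S.Δ ^ n) := (S.zpow_prefixLE_zpow hlt).trans h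
  refine hΔ (S.eq_one_of_mem_of_inv_mem _ S.Δ_mem ?_)
  simpa [PrefixLE, zpow_add] using h1

theorem zpow_prefixLE_iff_inv {x : G} {n : ℤ} :
    S.PrefixLE (S.Δ ^ n) x ↔ S.PrefixLE x⁻¹ (S.Δ ^ (-n)) := by
  rw [PrefixLE, PrefixLE, ← S.conj_zpow_mem_iff (-n)]
  simp

/-- Every element lies below a power of `Δ`, because the simple elements generate `G`. -/
theorem exists_prefixLE_pow (x : G) : ∃ n : ℕ, S.PrefixLE x (S.Δ ^ n) := by
  have key : ∃ n : ℕ, S.PrefixLE x (S.Δ ^ n) ∧ S.PrefixLE x⁻¹ (S.Δ ^ n) := by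
    have hmul : ∀ {a b : G} {m n : ℕ}, S.PrefixLE a (S.Δ ^ m) → S.PrefixLE b (S.Δ ^ n) →
        S.PrefixLE (a * b) (S.Δ ^ (m + n)) := fun {a b m n} ha hb => by
      refine (S.mul_prefixLE_mul_left.2 hb).trans ?_
      rw [pow_add]
      have := (S.mul_prefixLE_mul_zpow n).2 ha
      simpa using this
    have hx : x ∈ Subgroup.closure {a : G | a ∈ S.P ∧ a⁻¹ * S.Δ ∈ S.P} := by
      rw [S.closure_simple]; trivial
    induction hx using Subgroup.closure_induction with
    | mem a ha =>
      refine ⟨1, by simpa [PrefixLE] using ha.2, ?_⟩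
      simpa [PrefixLE] using S.P.mul_mem ha.1 S.Δ_mem
    | one => exact ⟨0, by simp [S.P.one_mem]⟩
    | mul a b _ _ iha ihb =>
      obtain ⟨m, hm, hm'⟩ := iha
      obtain ⟨n, hn, hn'⟩ := ihb
      refine ⟨m + n, hmul hm hn, ?_⟩
      rw [mul_inv_rev, add_comm]
      exact hmul hn' hm'
    | inv a _ ih =>
      obtain ⟨n, hn, hn'⟩ := ih
      exact ⟨n, hn', by simpa using hn⟩
  exact key.imp fun _ h => h.1

theorem exists_zpow_prefixLE (x : G) : ∃ n : ℕ, S.PrefixLE (S.Δ ^ (-n : ℤ)) x := by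
  obtain ⟨n, hn⟩ := S.exists_prefixLE_pow x⁻¹
  refine ⟨n, ?_⟩
  rw [zpow_prefixLE_iff_inv]
  simpa using hn

/-- A divisor `x` of `Δ ^ (n + 1)` becomes a divisor of `Δ ^ n` once its first factor `x ∧ Δ` is
removed. -/
theorem prefixLE_meet_mul_pow {x : G} (n : ℕ) (hx : S.PrefixLE x (S.Δ ^ (n + 1))) :
    S.PrefixLE x (S.meet x S.Δ * S.Δ ^ n) := by
  have h := S.meet_mul_zpow x S.Δ n
  rw [zpow_natCast] at h
  rw [h]
  refine PrefixLE.meet ?_ (by rwa [← pow_succ'])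
  simpa [PrefixLE] using S.P.pow_mem S.Δ_mem n

variable {S} in
theorem eq_one_of_meet_eq_one {x : G} (hx : x ∈ S.P) (h : S.meet x S.Δ = 1) : x = 1 := by
  obtain ⟨n, hn⟩ := S.exists_prefixLE_pow x
  induction n with
  | zero => exact PrefixLE.antisymm (by simpa using hn) (by simpa using hx)
  | succ n ih => exact ih (by simpa [h] using S.prefixLE_meet_mul_pow n hn)

/-! ### The norm -/

/-- The boundedness of factorisation lengths, including the case `x = 1`, where only the empty
factorisation exists. -/
theorem bddAbove_factorization_length {x : G} (hx : x ∈ S.P) :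
    BddAbove {k : ℕ | ∃ l : List G, l.length = k ∧ (∀ a ∈ l, a ∈ S.P ∧ a ≠ 1) ∧ l.prod = x} := by
  rcases eq_or_ne x 1 with rfl | hne
  · refine ⟨0, ?_⟩
    rintro _ ⟨l, rfl, hl, hprod⟩
    cases l with
    | nil => simp
    | cons a t =>
      rw [List.prod_cons] at hprod
      refine absurd (S.eq_one_of_mem_of_inv_mem a (hl a (by simp)).1 ?_) (hl a (by simp)).2
      rw [inv_eq_of_mul_eq_one_right hprod]
      exact S.P.list_prod_mem fun b hb => (hl b (by simp [hb])).1
  · exact S.bddAbove_length x hx hne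

variable {S} in
theorem posNorm_add_le {u v : G} (hu : u ∈ S.P) (hv : v ∈ S.P) :
    S.posNorm u + S.posNorm v ≤ S.posNorm (u * v) := by
  have hmem : ∀ {w : G}, w ∈ S.P → ∃ l : List G, l.length = S.posNorm w ∧
      (∀ a ∈ l, a ∈ S.P ∧ a ≠ 1) ∧ l.prod = w := fun {w} hw => by
    refine Nat.sSup_mem ?_ (S.bddAbove_factorization_length hw)
    rcases eq_or_ne w 1 with rfl | hw1
    · exact ⟨0, [], by simp⟩
    · exact ⟨1, [w], by simp [hw, hw1]⟩
  obtain ⟨l, hlen, hl, hprod⟩ := hmem hu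
  obtain ⟨l', hlen', hl', hprod'⟩ := hmem hv
  refine le_csSup (S.bddAbove_factorization_length (S.P.mul_mem hu hv))
    ⟨l ++ l', ?_, fun a ha => ?_, ?_⟩
  · simp [hlen, hlen']
  · exact (List.mem_append.1 ha).elim (hl a) (hl' a)
  · simp [hprod, hprod']

variable {S} in
theorem posNorm_pos {u : G} (hu : u ∈ S.P) (hu1 : u ≠ 1) : 0 < S.posNorm u :=
  le_csSup (S.bddAbove_factorization_length hu) ⟨[u], by simp [hu, hu1]⟩

theorem posNorm_inv_mul_lt {b y z : G} (hby : S.PrefixLE b y) (hyz : S.PrefixLE y z)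
    (hne : y ≠ z) : S.posNorm (b⁻¹ * y) < S.posNorm (b⁻¹ * z) := by
  have h1 := posNorm_pos hyz (by rwa [Ne, inv_mul_eq_one])
  have h2 := posNorm_add_le hby hyz
  rw [mul_assoc, mul_inv_cancel_left] at h2
  omega

/-! ### Left normal forms -/

theorem rightCompl_prefixLE {a : G} (ha : a ∈ S.P) : S.PrefixLE (S.rightCompl a) S.Δ := by
  have := (S.conj_mem_iff a).2 ha
  simpa [PrefixLE, rightCompl, mul_assoc] using this

/-- The greedy factorisation of a positive element: split off `x ∧ Δ` and recurse on the norm. The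
factor `Δ` does not appear: if `a = x ∧ Δ` and `Δ ≼ a⁻¹ x`, then `∂(a) ≼ Δ ≼ a⁻¹ x`, so left
weightedness gives `∂(a) = 1`, that is, `a = Δ ≼ x`. -/
theorem exists_leftWeighted_list {x : G} (hx : x ∈ S.P) (hΔx : ¬ S.PrefixLE S.Δ x) :
    ∃ l : List G, l.prod = x ∧ (∀ a ∈ l, a ∈ S.simples ∧ a ≠ 1 ∧ a ≠ S.Δ) ∧
      l.IsChain S.IsLeftWeighted ∧ ∀ a ∈ l.head?, a = S.meet x S.Δ := by
  induction hn : S.posNorm x using Nat.strong_induction_on generalizing x with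
  | _ n ih =>
    rcases eq_or_ne x 1 with rfl | hx1
    · exact ⟨[], by simp⟩
    set a := S.meet x S.Δ with ha
    have ha1 : a ≠ 1 := fun h => hx1 (eq_one_of_meet_eq_one hx h)
    have haP : a ∈ S.P := S.one_prefixLE.1
      (PrefixLE.meet (S.one_prefixLE.2 hx) (S.one_prefixLE.2 S.Δ_mem))
    have hyP : a⁻¹ * x ∈ S.P := S.meet_prefixLE_left x S.Δ
    have hmeet : S.meet (a⁻¹ * S.Δ) (a⁻¹ * x) = 1 := by
      rw [← mul_meet, meet_comm, ← ha, inv_mul_cancel]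
    have haΔ : S.PrefixLE a S.Δ := S.meet_prefixLE_right x S.Δ
    have haneΔ : a ≠ S.Δ := fun h => hΔx (h ▸ S.meet_prefixLE_left x S.Δ)
    have hΔy : ¬ S.PrefixLE S.Δ (a⁻¹ * x) := fun h => by
      have h1 : S.PrefixLE (a⁻¹ * S.Δ) (a⁻¹ * x) := by
        exact (S.rightCompl_prefixLE haP).trans h
      rw [h1.meet_eq_left, inv_mul_eq_one] at hmeet
      exact haneΔ hmeet
    have hlt : S.posNorm (a⁻¹ * x) < n := by
      have h1 := posNorm_pos haP ha1
      have h2 := posNorm_add_le haP hyP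
      rw [mul_inv_cancel_left, hn] at h2
      omega
    obtain ⟨l, hl, hls, hlc, hlh⟩ := ih _ hlt hyP hΔy rfl
    refine ⟨a :: l, by simp [hl], ?_, ?_, by simp⟩
    · intro b hb
      rcases List.mem_cons.1 hb with rfl | hb
      · exact ⟨⟨S.one_prefixLE.2 haP, haΔ⟩, ha1, haneΔ⟩
      · exact hls b hb
    · rw [List.isChain_cons]
      refine ⟨fun b hb => ?_, hlc⟩
      rw [hlh b hb, IsLeftWeighted, rightCompl]
      refine PrefixLE.antisymm (S := S) ?_ ?_
      · rw [← hmeet]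
        exact (S.meet_prefixLE_left _ _).meet
          ((S.meet_prefixLE_right _ _).trans (S.meet_prefixLE_left _ _))
      · exact (S.one_prefixLE.2 haΔ).meet
          ((S.one_prefixLE.2 hyP).meet (S.one_prefixLE.2 S.Δ_mem))

theorem exists_isLeftNormalForm (hΔ : S.Δ ≠ 1) (x : G) :
    ∃ f : ℤ × List G, S.IsLeftNormalForm x f.1 f.2 := by
  obtain ⟨N, hN⟩ := S.exists_prefixLE_pow x
  obtain ⟨M, hM⟩ := S.exists_zpow_prefixLE x
  obtain ⟨p, hp, hmax⟩ := Int.exists_greatest_of_bdd (P := fun q => S.PrefixLE (S.Δ ^ q) x)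
    ⟨N, fun q hq => le_of_zpow_prefixLE_zpow hΔ (hq.trans (by simpa using hN))⟩ ⟨_, hM⟩
  have hΔy : ¬ S.PrefixLE S.Δ ((S.Δ ^ p)⁻¹ * x) := fun h => by
    have := hmax (p + 1) (by simpa [PrefixLE, zpow_add, mul_assoc] using h)
    omega
  obtain ⟨l, hl, hls, hlc, -⟩ := S.exists_leftWeighted_list hp hΔy
  exact ⟨(p, l), by simp [hl], hls, hlc⟩

variable {S} in
theorem prod_mem_of_forall_mem_simples {l : List G} (hl : ∀ a ∈ l, a ∈ S.simples) :
    l.prod ∈ S.P :=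
  S.P.list_prod_mem fun a ha => S.one_prefixLE.1 (hl a ha).1

variable {S} in
/-- The first factor of a left weighted product is the meet of the product with `Δ`. -/
theorem meet_prod_cons {a : G} {l : List G} (hs : ∀ b ∈ a :: l, b ∈ S.simples)
    (hc : (a :: l).IsChain S.IsLeftWeighted) : S.meet (a * l.prod) S.Δ = a := by
  induction l generalizing a with
  | nil => simpa using (hs a (by simp)).2.meet_eq_left
  | cons b t ih =>
    have hb := ih (fun c hc => hs c (by simp [hc])) hc.of_cons
    have haP : a ∈ S.P := S.one_prefixLE.1 (hs a (by simp)).1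
    have hab : S.meet (S.rightCompl a) b = 1 := hc.rel
    have hΔ : S.Δ = a * S.rightCompl a := by simp [rightCompl]
    rw [List.prod_cons]
    conv_lhs => rw [hΔ, ← mul_meet]
    rw [mul_eq_left]
    refine PrefixLE.antisymm (S := S) ?_ ?_
    · rw [← hab]
      refine (S.meet_prefixLE_right _ _).meet ?_
      conv_rhs => rw [← hb]
      exact (S.meet_prefixLE_left _ _).meet
        ((S.meet_prefixLE_right _ _).trans (S.rightCompl_prefixLE haP))
    · refine PrefixLE.meet ?_ ?_
      · rw [← List.prod_cons, one_prefixLE]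
        exact prod_mem_of_forall_mem_simples fun c hc => hs c (by simp [List.mem_cons.1 hc])
      · exact S.one_prefixLE.2 (hs a (by simp)).2

variable {S} in
theorem length_le_of_prod_prefixLE {l : List G} (hs : ∀ a ∈ l, a ∈ S.simples ∧ a ≠ 1)
    (hc : l.IsChain S.IsLeftWeighted) {n : ℕ} (hn : S.PrefixLE l.prod (S.Δ ^ n)) :
    l.length ≤ n := by
  induction l generalizing n with
  | nil => simp
  | cons a t ih =>
    have ha := meet_prod_cons (fun b hb => (hs b hb).1) hc
    rw [List.prod_cons] at hn
    cases n with
    | zero =>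
      have h1 : a * t.prod = 1 := by
        refine PrefixLE.antisymm (by simpa using hn) ?_
        rw [← List.prod_cons, one_prefixLE]
        exact prod_mem_of_forall_mem_simples fun b hb => (hs b hb).1
      rw [h1, (S.one_prefixLE.2 S.Δ_mem).meet_eq_left] at ha
      exact absurd ha.symm (hs a (by simp)).2
    | succ n =>
      have h1 := S.prefixLE_meet_mul_pow n hn
      rw [ha, mul_prefixLE_mul_left] at h1
      simpa using ih (fun b hb => hs b (by simp [hb])) hc.of_cons h1

variable {S} in
theorem prod_prefixLE_pow_length {l : List G} (hs : ∀ a ∈ l, a ∈ S.simples) :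
    S.PrefixLE l.prod (S.Δ ^ l.length) := by
  induction l with
  | nil => simp [S.P.one_mem]
  | cons a t ih =>
    rw [List.prod_cons, List.length_cons, pow_succ']
    refine (S.mul_prefixLE_mul_left.2 (ih fun b hb => hs b (by simp [hb]))).trans ?_
    have := (S.mul_prefixLE_mul_zpow t.length).2 (hs a (by simp)).2
    simpa using this

variable {S} in
theorem isLeftNormalForm_leftNormalForm (hΔ : S.Δ ≠ 1) (x : G) :
    S.IsLeftNormalForm x (S.infimum x) (S.leftNormalForm x).2 :=
  Classical.epsilon_spec (S.exists_isLeftNormalForm hΔ x)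

variable {S} in
/-- The infimum, read off from the left normal form, is the largest `q` with `Δ ^ q ≼ x`. -/
theorem zpow_prefixLE_iff_le_infimum (hΔ : S.Δ ≠ 1) {x : G} {q : ℤ} :
    S.PrefixLE (S.Δ ^ q) x ↔ q ≤ S.infimum x := by
  obtain ⟨hx, hs, hc⟩ := isLeftNormalForm_leftNormalForm hΔ x
  set l := (S.leftNormalForm x).2
  have hp : S.PrefixLE (S.Δ ^ S.infimum x) x := by
    have := prod_mem_of_forall_mem_simples fun a ha => (hs a ha).1
    conv_rhs => rw [hx]
    simpa [PrefixLE] using this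
  refine ⟨fun h => ?_, fun h => (S.zpow_prefixLE_zpow h).trans hp⟩
  by_contra! hlt
  have h1 : S.PrefixLE (S.Δ ^ (S.infimum x + 1)) x := (S.zpow_prefixLE_zpow hlt).trans h
  conv_rhs at h1 => rw [hx]
  rw [zpow_add_one, mul_prefixLE_mul_left] at h1
  cases hl : l with
  | nil =>
    rw [hl, List.prod_nil] at h1
    exact hΔ (h1.antisymm (S.one_prefixLE.2 S.Δ_mem))
  | cons a t =>
    rw [hl] at h1 hs hc
    have h2 := meet_prod_cons (fun b hb => (hs b hb).1) hc
    rw [← List.prod_cons, meet_comm, h1.meet_eq_left] at h2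
    exact (hs a (by simp)).2.2 h2.symm

variable {S} in
/-- The supremum is the smallest `q` with `x ≼ Δ ^ q`. -/
theorem prefixLE_zpow_iff_supremum_le (hΔ : S.Δ ≠ 1) {x : G} {q : ℤ} :
    S.PrefixLE x (S.Δ ^ q) ↔ S.supremum x ≤ q := by
  obtain ⟨hx, hs, hc⟩ := isLeftNormalForm_leftNormalForm hΔ x
  rw [supremum, canonicalLength]
  set l := (S.leftNormalForm x).2
  have hl : S.PrefixLE x (S.Δ ^ q) ↔ S.PrefixLE l.prod (S.Δ ^ (q - S.infimum x)) := by
    conv_lhs => rw [hx, ← add_sub_cancel (S.infimum x) q, zpow_add, mul_prefixLE_mul_left]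
  rw [hl]
  constructor
  · intro h
    have h0 : S.PrefixLE (S.Δ ^ (0 : ℤ)) l.prod := by
      rw [zpow_zero, one_prefixLE]
      exact prod_mem_of_forall_mem_simples fun a ha => (hs a ha).1
    obtain ⟨n, hn⟩ := Int.eq_ofNat_of_zero_le (le_of_zpow_prefixLE_zpow hΔ (h0.trans h))
    rw [hn, zpow_natCast] at h
    have := length_le_of_prod_prefixLE (fun a ha => ⟨(hs a ha).1, (hs a ha).2.1⟩) hc h
    omega
  · intro h
    have h1 := prod_prefixLE_pow_length fun a ha => (hs a ha).1
    rw [← zpow_natCast] at h1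
    exact h1.trans (S.zpow_prefixLE_zpow (by omega))

variable {S} in
theorem infimum_inv (hΔ : S.Δ ≠ 1) (x : G) : S.infimum x⁻¹ = -S.supremum x := by
  refine eq_of_forall_le_iff fun q => ?_
  rw [← zpow_prefixLE_iff_le_infimum hΔ, zpow_prefixLE_iff_inv, inv_inv,
    prefixLE_zpow_iff_supremum_le hΔ, le_neg]

variable {S} in
theorem supremum_inv (hΔ : S.Δ ≠ 1) (x : G) : S.supremum x⁻¹ = -S.infimum x := by
  rw [← neg_eq_iff_eq_neg, ← infimum_inv hΔ, inv_inv]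

variable {S} in
theorem canonicalLength_inv (hΔ : S.Δ ≠ 1) (x : G) :
    S.canonicalLength x⁻¹ = S.canonicalLength x := by
  have h1 := infimum_inv hΔ x
  have h2 := supremum_inv hΔ x
  unfold supremum at h1 h2
  omega

variable {S} in
/-- The elements conjugating `x` to an element of infimum at least `q` are the points below their
image under an automorphism of the prefix order. -/
theorem le_infimum_conj_iff (hΔ : S.Δ ≠ 1) {x a : G} {q : ℤ} :
    q ≤ S.infimum (a⁻¹ * x * a) ↔ S.PrefixLE a (S.translate x (-q) a) := by
  rw [← zpow_prefixLE_iff_le_infimum hΔ, ← S.mul_prefixLE_mul_left (c := a),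
    ← S.mul_prefixLE_mul_zpow (-q)]
  simp [translate, mul_assoc]

/-! ### Cyclic sliding and the infimum -/

variable {S} in
theorem translate_comm {x y : G} (h : Commute x y) (m n : ℤ) (a : G) :
    S.translate x m (S.translate y n a) = S.translate y n (S.translate x m a) := by
  rw [translate_translate, translate_translate, h.eq, add_comm]

variable {S} in
theorem PrefixLE.meet_translate {x a b : G} {n : ℤ} (ha : S.PrefixLE a (S.translate x n a))
    (hb : S.PrefixLE b (S.translate x n b)) :
    S.PrefixLE (S.meet a b) (S.translate x n (S.meet a b)) := by
  rw [translate_meet]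
  exact ((S.meet_prefixLE_left a b).trans ha).meet ((S.meet_prefixLE_right a b).trans hb)

variable {S} in
theorem PrefixLE.translate_of_commute {x y a : G} {n : ℤ} (ha : S.PrefixLE a (S.translate x n a))
    (hxy : Commute x y) (m : ℤ) :
    S.PrefixLE (S.translate y m a) (S.translate x n (S.translate y m a)) := by
  rwa [translate_comm hxy, translate_prefixLE_translate]

variable {S} in
theorem mul_preferredPrefix_conj (hΔ : S.Δ ≠ 1) (x a : G) :
    a * S.preferredPrefix (a⁻¹ * x * a) =
      S.meet (S.meet (S.translate x (-S.infimum (a⁻¹ * x * a)) a) (a * S.Δ))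
        (S.meet (S.translate x⁻¹ (S.supremum (a⁻¹ * x * a)) a) (a * S.Δ)) := by
  rw [preferredPrefix, initialFactor, initialFactor, infimum_inv hΔ, mul_meet, mul_meet, mul_meet]
  simp [translate, mul_assoc]

theorem cyclicSliding_inv (x : G) : S.cyclicSliding x⁻¹ = (S.cyclicSliding x)⁻¹ := by
  simp [cyclicSliding, preferredPrefix, S.meet_comm, mul_assoc]

theorem cyclicSliding_iterate_inv (m : ℕ) (x : G) :
    S.cyclicSliding^[m] x⁻¹ = (S.cyclicSliding^[m] x)⁻¹ :=
  ((Function.Semiconj.iterate_right (f := fun x : G => x⁻¹)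
    (fun x => (S.cyclicSliding_inv x).symm) m) x).symm

theorem isConj_cyclicSliding (x : G) : IsConj x (S.cyclicSliding x) :=
  isConj_iff.2 ⟨(S.preferredPrefix x)⁻¹, by simp [cyclicSliding]⟩

variable {S} in
/-- The conjugators that do not decrease the infimum are closed under meets and under translations
commuting with `x`, and `𝔭(x)` is a meet of translates of `1`. -/
theorem infimum_le_infimum_cyclicSliding (hΔ : S.Δ ≠ 1) (x : G) :
    S.infimum x ≤ S.infimum (S.cyclicSliding x) := by
  have h1 : S.PrefixLE 1 (S.translate x (-S.infimum x) 1) :=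
    (le_infimum_conj_iff hΔ).1 (by simp)
  have hΔ1 : S.Δ = S.translate 1 1 1 := by simp [translate]
  have hp := mul_preferredPrefix_conj hΔ x 1
  simp only [inv_one, one_mul, mul_one] at hp
  rw [cyclicSliding, le_infimum_conj_iff hΔ, hp]
  have hd : S.PrefixLE S.Δ (S.translate x (-S.infimum x) S.Δ) := by
    rw [hΔ1]
    exact h1.translate_of_commute (Commute.one_right x) 1
  exact ((h1.translate_of_commute (Commute.refl x) _).meet_translate hd).meet_translate
    ((h1.translate_of_commute (Commute.inv_right (Commute.refl x)) _).meet_translate hd)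

variable {S} in
theorem infimum_le_infimum_iterate (hΔ : S.Δ ≠ 1) (x : G) (m : ℕ) :
    S.infimum x ≤ S.infimum (S.cyclicSliding^[m] x) := by
  induction m with
  | zero => simp
  | succ m ih =>
    rw [Function.iterate_succ_apply']
    exact ih.trans (infimum_le_infimum_cyclicSliding hΔ _)

variable {S} in
theorem supremum_iterate_le (hΔ : S.Δ ≠ 1) (x : G) (m : ℕ) :
    S.supremum (S.cyclicSliding^[m] x) ≤ S.supremum x := by
  have := infimum_le_infimum_iterate hΔ x⁻¹ m
  rw [cyclicSliding_iterate_inv, infimum_inv hΔ, infimum_inv hΔ] at this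
  omega

variable {S} in
/-- A conjugator to an element of larger infimum can be chosen below `1`, by multiplying it with a
negative power of `Δ`. -/
theorem exists_prefixLE_translate_of_infimum_lt (hΔ : S.Δ ≠ 1) {x z : G} (hxz : IsConj x z)
    (hlt : S.infimum x < S.infimum z) :
    ∃ b, S.PrefixLE b 1 ∧ S.PrefixLE b (S.translate x (-(S.infimum x + 1)) b) := by
  obtain ⟨g, rfl⟩ := isConj_iff.1 hxz
  obtain ⟨N, hN⟩ := S.exists_prefixLE_pow g⁻¹
  refine ⟨S.translate 1 (-N) g⁻¹, ?_, ?_⟩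
  · rw [← S.mul_prefixLE_mul_zpow N]
    simpa [translate] using hN
  · refine PrefixLE.translate_of_commute ?_ (Commute.one_right x) _
    exact (le_infimum_conj_iff hΔ).1 (by simpa using hlt)

variable {S} in
/-- An element of length at most one has maximal infimum in its conjugacy class. -/
theorem infimum_le_of_canonicalLength_le_one (hΔ : S.Δ ≠ 1) {x z : G} (hxz : IsConj x z)
    (hx : S.canonicalLength x ≤ 1) : S.infimum z ≤ S.infimum x := by
  by_contra! hlt
  obtain ⟨b, hb1, hb⟩ := exists_prefixLE_translate_of_infimum_lt hΔ hxz hlt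
  set h := S.translate x (-(S.infimum x + 1)) with hdef
  have hiter : ∀ j u v, S.PrefixLE (h^[j] u) (h^[j] v) ↔ S.PrefixLE u v := fun j u v => by
    induction j with
    | zero => simp
    | succ j ih => rw [Function.iterate_succ_apply', Function.iterate_succ_apply',
        translate_prefixLE_translate, ih]
  have h1 : S.PrefixLE (h 1) 1 := by
    have : S.PrefixLE x (S.Δ ^ (S.infimum x + 1)) :=
      (prefixLE_zpow_iff_supremum_le hΔ).2 (by unfold supremum; omega)
    rw [← S.mul_prefixLE_mul_zpow (-(S.infimum x + 1))] at this
    simpa [hdef, translate, ← zpow_add] using this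
  let _ := S.semilatticeInf
  have hc : ∀ j, h^[j + 1] 1 = h^[j] 1 ⊓ h (h^[j] 1) := fun j => by
    rw [← Function.iterate_succ_apply' h j 1]
    refine (inf_eq_right.2 ?_).symm
    rw [Function.iterate_succ_apply]
    exact (hiter j _ _).2 h1
  obtain ⟨J, hJ⟩ := exists_le_map hc
    (le_of_le_map_of_le (c := fun j => h^[j] 1) (S.translate_meet x _) hc hb hb1)
    (ν := fun y => S.posNorm (b⁻¹ * y))
    (fun y z hy hyz => S.posNorm_inv_mul_lt hy hyz.le hyz.ne)
  rw [← Function.iterate_succ_apply' h J 1, Function.iterate_succ_apply] at hJ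
  have h2 : S.PrefixLE 1 (h 1) := (hiter J _ _).1 hJ
  have h3 := (le_infimum_conj_iff hΔ).2 h2
  simp at h3

variable {S} in
/-- If the infimum of `x` is not maximal in its conjugacy class and `ℓ(x) ≥ 2`, then `‖Δ‖ - 1`
cyclic slidings shorten `x`. -/
theorem canonicalLength_iterate_lt_of_infimum_lt (hΔ : S.Δ ≠ 1) {x z : G} (hxz : IsConj x z)
    (hlt : S.infimum x < S.infimum z) (hx : 2 ≤ S.canonicalLength x) {k : ℕ}
    (hk : S.posNorm S.Δ ≤ k + 1) :
    S.canonicalLength (S.cyclicSliding^[k] x) < S.canonicalLength x := by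
  by_contra! hcon
  -- Infimum and supremum are monotone along the orbit, so constant length makes both constant.
  have hconst : ∀ j ≤ k, S.infimum (S.cyclicSliding^[j] x) = S.infimum x ∧
      S.supremum (S.cyclicSliding^[j] x) = S.supremum x := fun j hj => by
    have h1 := infimum_le_infimum_iterate hΔ x j
    have h2 := supremum_iterate_le hΔ x j
    have h3 := infimum_le_infimum_iterate hΔ (S.cyclicSliding^[j] x) (k - j)
    have h4 := supremum_iterate_le hΔ (S.cyclicSliding^[j] x) (k - j)
    rw [← Function.iterate_add_apply, Nat.sub_add_cancel hj] at h3 h4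
    have h5 : S.supremum (S.cyclicSliding^[k] x) =
      S.infimum (S.cyclicSliding^[k] x) + S.canonicalLength (S.cyclicSliding^[k] x) := rfl
    have h6 : S.supremum x = S.infimum x + S.canonicalLength x := rfl
    omega
  -- `u j` is the product of the first `j` preferred prefixes, so that it
  -- conjugates `x` to `𝔰^j(x)`.
  let u : ℕ → G := fun j =>
    ((List.range j).map fun i => S.preferredPrefix (S.cyclicSliding^[i] x)).prod
  have hu : ∀ j, u (j + 1) = u j * S.preferredPrefix (S.cyclicSliding^[j] x) := fun j => by
    simp [u, List.range_succ]
  have hux : ∀ j, S.cyclicSliding^[j] x = (u j)⁻¹ * x * u j := fun j => by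
    induction j with
    | zero => simp [u]
    | succ j ih =>
      rw [Function.iterate_succ_apply', cyclicSliding, hu]
      conv_lhs => enter [1, 2]; rw [ih]
      simp [mul_assoc]
  -- Dividing by `Δ^j` turns the sliding recursion into `a ↦ a ∧ h(a) ∧ h'(a)`.
  let a : ℕ → G := fun j => u j * S.Δ ^ (-j : ℤ)
  obtain ⟨b₀, hb1, hb⟩ := exists_prefixLE_translate_of_infimum_lt hΔ hxz hlt
  set h := S.translate x (-(S.infimum x + 1)) with hdef
  set h' := S.translate x⁻¹ (S.supremum x - 1) with hdef'
  let _ := S.semilatticeInf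
  have hh : ∀ v w, h (v ⊓ w) = h v ⊓ h w := S.translate_meet x _
  have hhh' : ∀ v, v ≤ h (h' v) := fun v => by
    have h2 : S.PrefixLE (v * S.Δ ^ (0 : ℤ)) (v * S.Δ ^ (S.supremum x - 1 + -(S.infimum x + 1))) :=
      S.mul_zpow_prefixLE_mul_zpow v (by unfold supremum; omega)
    change S.PrefixLE v (h (h' v))
    rw [hdef, hdef', translate_translate]
    simpa [translate] using h2
  let c : ℕ → G := fun j => (fun v => v ⊓ h v)^[j] 1
  have hc : ∀ j, c (j + 1) = c j ⊓ h (c j) := fun j => Function.iterate_succ_apply' _ _ _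
  have hνlt : ∀ b y z : G, b ≤ y → y < z → S.posNorm (b⁻¹ * y) < S.posNorm (b⁻¹ * z) :=
    fun b y z hy hyz => S.posNorm_inv_mul_lt hy hyz.le hyz.ne
  obtain ⟨J, hJ⟩ := exists_le_map hc (fun j => le_of_le_map_of_le hh hc hb hb1 j) (hνlt b₀)
  have hanti : Antitone c := antitone_nat_of_succ_le fun j => by rw [hc]; exact inf_le_left
  have hbd : c J < c J * S.Δ := by
    refine lt_of_le_of_ne ?_ (by simpa using hΔ)
    have := S.mul_zpow_prefixLE_mul_zpow (c J) (zero_le_one (α := ℤ))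
    change S.PrefixLE (c J) (c J * S.Δ)
    simpa using this
  have hck : c k = c J := by
    refine eq_of_norm_le hh hc (fun j => le_of_le_map_of_le hh hc hJ (hanti (Nat.zero_le J)) j)
      (fun y hy hy0 => le_of_le_map_of_le hh hc hy hy0 J) hbd ?_ ?_ (hνlt (c J)) ?_
    · have h2 : c J * S.Δ = S.translate 1 1 (c J) := by simp [translate]
      rw [h2]
      exact PrefixLE.translate_of_commute hJ (Commute.one_right x) 1
    · intro y hy hyd
      have h2 : S.meet y (c J * S.Δ) = c J := hyd
      have h3 := S.mul_meet (c J)⁻¹ y (c J * S.Δ)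
      rw [h2, inv_mul_cancel, inv_mul_cancel_left] at h3
      exact (inv_mul_eq_one.1 (eq_one_of_meet_eq_one hy h3.symm)).symm
    · rw [inv_mul_cancel_left]
      omega
  have ha : ∀ j < k, a (j + 1) = a j ⊓ h (a j) ⊓ h' (a j) := fun j hj => by
    obtain ⟨h2, h3⟩ := hconst j hj.le
    have h4 := mul_preferredPrefix_conj hΔ x (u j)
    rw [← hux, ← hu, h2, h3] at h4
    have e1 : u j * S.Δ * S.Δ ^ (-(j + 1 : ℤ)) = a j := by
      simp [a, zpow_add, mul_assoc]
    have e2 : S.translate x (-S.infimum x) (u j) * S.Δ ^ (-(j + 1 : ℤ)) = h (a j) := by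
      simp only [a, hdef, translate, mul_assoc, ← zpow_add]
      ring_nf
    have e3 : S.translate x⁻¹ (S.supremum x) (u j) * S.Δ ^ (-(j + 1 : ℤ)) = h' (a j) := by
      simp only [a, hdef', translate, mul_assoc, ← zpow_add]
      ring_nf
    calc
      a (j + 1) = u (j + 1) * S.Δ ^ (-(j + 1 : ℤ)) := by
        simp only [a, Nat.cast_add, Nat.cast_one]
      _ = h (a j) ⊓ a j ⊓ (h' (a j) ⊓ a j) := by
        rw [h4, meet_mul_zpow, meet_mul_zpow, meet_mul_zpow, e1, e2, e3]
        rfl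
      _ = a j ⊓ h (a j) ⊓ h' (a j) := by
        rw [← inf_inf_distrib_right, inf_comm, inf_assoc]
  have hak : S.PrefixLE (a k) (h (a k)) :=
    le_map_of_stable hh hc hhh' (by simp [a, u, c]) ha (hck ▸ hJ)
  have huk : S.PrefixLE (u k) (h (u k)) := by
    have e : a k = S.translate 1 (-k) (u k) := by simp [a, translate]
    rwa [e, hdef, translate_comm (Commute.one_right x), translate_prefixLE_translate] at hak
  have := (le_infimum_conj_iff hΔ).2 huk
  rw [← hux, (hconst k le_rfl).1] at this
  omega

/-! ### The super summit set -/

variable {S} in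
theorem superSummitSet_eq_of_isConj {x y : G} (hxy : IsConj x y) :
    S.superSummitSet x = S.superSummitSet y := by
  have hc : ∀ z, IsConj x z ↔ IsConj y z := fun z => ⟨hxy.symm.trans, hxy.trans⟩
  simp only [superSummitSet, hc]

theorem isConj_iterate_cyclicSliding (x : G) (m : ℕ) : IsConj x (S.cyclicSliding^[m] x) := by
  induction m with
  | zero => exact IsConj.refl x
  | succ m ih =>
    rw [Function.iterate_succ_apply']
    exact ih.trans (S.isConj_cyclicSliding _)

variable {S} in
theorem iterate_cyclicSliding_mem_superSummitSet (hΔ : S.Δ ≠ 1) {x : G}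
    (hx : x ∈ S.superSummitSet x) (m : ℕ) : S.cyclicSliding^[m] x ∈ S.superSummitSet x :=
  ⟨S.isConj_iterate_cyclicSliding x m,
    fun z hz => (hx.2.1 z hz).trans (infimum_le_infimum_iterate hΔ x m),
    fun z hz => (supremum_iterate_le hΔ x m).trans (hx.2.2 z hz)⟩

theorem isConj_inv_inv {x z : G} (h : IsConj x z) : IsConj x⁻¹ z⁻¹ := by
  obtain ⟨g, rfl⟩ := isConj_iff.1 h
  exact isConj_iff.2 ⟨g, by simp [mul_assoc]⟩

variable {S} in
theorem mem_superSummitSet_of_canonicalLength_le_one (hΔ : S.Δ ≠ 1) {x : G}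
    (hx : S.canonicalLength x ≤ 1) : x ∈ S.superSummitSet x := by
  refine ⟨IsConj.refl x, fun z hz => infimum_le_of_canonicalLength_le_one hΔ hz hx,
    fun z hz => ?_⟩
  have := infimum_le_of_canonicalLength_le_one hΔ (isConj_inv_inv hz)
    (by rwa [canonicalLength_inv hΔ])
  rw [infimum_inv hΔ, infimum_inv hΔ] at this
  omega

variable {S} in
theorem canonicalLength_iterate_lt (hΔ : S.Δ ≠ 1) {x : G} (hx : x ∉ S.superSummitSet x) {k : ℕ}
    (hk : S.posNorm S.Δ ≤ k + 1) :
    S.canonicalLength (S.cyclicSliding^[k] x) < S.canonicalLength x := by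
  have h2 : 2 ≤ S.canonicalLength x := by
    by_contra! hlt
    exact hx (mem_superSummitSet_of_canonicalLength_le_one hΔ (by omega))
  by_cases hinf : ∃ z, IsConj x z ∧ S.infimum x < S.infimum z
  · obtain ⟨z, hz, hlt⟩ := hinf
    exact canonicalLength_iterate_lt_of_infimum_lt hΔ hz hlt h2 hk
  · push Not at hinf
    obtain ⟨z, hz, hlt⟩ : ∃ z, IsConj x z ∧ S.supremum z < S.supremum x := by
      by_contra! hsup
      exact hx ⟨IsConj.refl x, hinf, hsup⟩
    have := canonicalLength_iterate_lt_of_infimum_lt hΔ (isConj_inv_inv hz)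
      (by rw [infimum_inv hΔ, infimum_inv hΔ]; omega) (by rwa [canonicalLength_inv hΔ]) hk
    rwa [cyclicSliding_iterate_inv, canonicalLength_inv hΔ, canonicalLength_inv hΔ] at this

variable {S} in
/-- Each round of `k ≥ ‖Δ‖ - 1` slidings shortens an element outside its super summit set, and the
elements of length at most one are inside. -/
theorem iterate_mem_superSummitSet (hΔ : S.Δ ≠ 1) {k : ℕ} (hk : S.posNorm S.Δ ≤ k + 1) {n : ℕ}
    {x : G} (hx : S.canonicalLength x ≤ n + 1) {m : ℕ} (hm : n * k ≤ m) :
    S.cyclicSliding^[m] x ∈ S.superSummitSet x := by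
  induction n generalizing x m with
  | zero =>
    exact iterate_cyclicSliding_mem_superSummitSet hΔ
      (mem_superSummitSet_of_canonicalLength_le_one hΔ hx) m
  | succ n ih =>
    by_cases hmem : x ∈ S.superSummitSet x
    · exact iterate_cyclicSliding_mem_superSummitSet hΔ hmem m
    · rw [add_one_mul] at hm
      have hlt := canonicalLength_iterate_lt hΔ hmem hk
      have := ih (x := S.cyclicSliding^[k] x) (m := m - k) (by omega) (by omega)
      rwa [← Function.iterate_add_apply, Nat.sub_add_cancel (by omega),
        ← superSummitSet_eq_of_isConj (S.isConj_iterate_cyclicSliding x k)] at this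

theorem subsingleton_of_delta_eq_one (hΔ : S.Δ = 1) : Subsingleton G := by
  have h1 : ∀ x : G, x ∈ S.P := fun x => by
    obtain ⟨n, hn⟩ := S.exists_zpow_prefixLE x
    simpa [hΔ] using hn
  exact ⟨fun a b => by
    rw [S.eq_one_of_mem_of_inv_mem a (h1 _) (h1 _), S.eq_one_of_mem_of_inv_mem b (h1 _) (h1 _)]⟩

end GarsideStructure

theorem mainTheorem7 {G : Type*} [Group G] (S : GarsideStructure G) (hS : S.IsFiniteType)
    (x : G) (r : ℕ) (hr : S.canonicalLength x = r) :
    ∃ M : ℤ, M ≤ ((r : ℤ) - 1) * ((S.posNorm S.Δ : ℤ) - 1) ∧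
      ∀ m : ℕ, M ≤ (m : ℤ) → S.cyclicSliding^[m] x ∈ S.superSummitSet x := by
  refine ⟨_, le_rfl, fun m hm => ?_⟩
  by_cases hΔ : S.Δ = 1
  -- `G` is trivial; the infimum is an arbitrary value, but the same for all elements.
  · have := S.subsingleton_of_delta_eq_one hΔ
    exact ⟨S.isConj_iterate_cyclicSliding x m,
      fun z _ => (congrArg S.infimum (Subsingleton.elim _ _)).le,
      fun z _ => (congrArg S.supremum (Subsingleton.elim _ _)).le⟩
  obtain ⟨k, hk⟩ := Nat.exists_eq_add_one.2 (GarsideStructure.posNorm_pos S.Δ_mem hΔ)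
  -- For `r = 0` the truncated `r - 1` is `0`, and every `m : ℕ` is admissible.
  refine GarsideStructure.iterate_mem_superSummitSet hΔ hk.le (n := r - 1) (by omega) ?_
  rcases r with _ | r
  · simp
  · rw [hk] at hm
    push_cast at hm
    simp only [add_sub_cancel_right] at hm
    exact_mod_cast hm
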